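/- Let $k$ be an algebraically closed field of characteristic zero and let $N\subseteq\mathbb N=\{0,1,2,\dots\}$ be a numerical semigroup (a submonoid of $(\mathbb N,+)$ with finite complement) with $g$ gaps (elements of $\mathbb N\setminus N$) and minimal system of generators $n_1<\dots<n_r$. Put $$\mathrm{ewt}(N)=\sum_{\ell\in\mathbb N\setminus N}\#\{j: n_j<\ell\},\qquad \mathrm{End}(N)=\{n\in\mathbb N: n+(N\setminus\{0\})\subseteq N\},\qquad \lambda(N)=\#(\mathrm{End}(N)\setminus N).$$ Let $k[N]=\bigoplus_{n\in N}k\,t^n$, let $I$ be the kernel of $P=k[X_1,\dots,X_r]\to k[N]$, $X_j\mapsto t^{n_j}$, where $X_j$ has weight $n_j$, and let $$T^1(k[N])=\operatorname{coker}\bigl(\operatorname{Hom}_{k[N]}(\Omega_{P/k}\otimes_P k[N],k[N])\to\operatorname{Hom}_{k[N]}(I/I^2,k[N])\bigr)$$ be the first cohomology module of the cotangent complex, with the induced $\mathbb Z$-grading; $T^{1,+}(k[N])=\bigoplus_{\ell>0}T^1(k[N])_\ell$ is its positive graded part. Then $T^{1,+}(k[N])$ is finite-dimensional over $k$ and $$3g-2-\mathrm{ewt}(N)\;\le\;2g-2+\lambda(N)-\dim_k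 T^{1,+}(k[N]).$$ More precisely, let $F_i=X^{\alpha_i}-X^{\beta_i}$ be any system of binomials generating $I$, where $\alpha_i,\beta_i\in\mathbb N^r$ have disjoint supports and $X^{\alpha_i}$ and $X^{\beta_i}$ have the same weight $d_i$. For $\ell\in\mathbb N$ let $V_\ell\subseteq k^r$ be the span of the vectors $\alpha_i-\beta_i$ for those $i$ with $d_i+\ell\notin N$. Then $$\bigl(2g-2+\lambda(N)-\dim_k T^{1,+}(k[N])\bigr)-\bigl(3g-2-\mathrm{ewt}(N)\bigr)=\sum_{\ell\in\mathbb N\setminus\mathrm{End}(N)}\dim_k V_\ell .$$ -/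

import Mathlib

noncomputable section

/-- A numerical semigroup: a submonoid of `(ℕ, +)` with finite complement. -/
structure NumericalSemigroup where
  /-- The underlying submonoid of `ℕ`. -/
  carrier : AddSubmonoid ℕ
  finite_compl : ((carrier : Set ℕ)ᶜ).Finite

namespace NumericalSemigroup

variable (N : NumericalSemigroup)

/-- The gaps of `N`: the natural numbers that are not in `N`. -/
def gaps : Finset ℕ := N.finite_compl.toFinset

/-- The genus of `N`: the number of gaps. -/
def genus : ℕ := N.gaps.card

/-- The minimal system of generators of `N`: the nonzero elements of `N` that are not a sum of
two nonzero elements of `N` (see `closure_minGens` and `minGens_subset`). -/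
def minGens : Set ℕ :=
  {n | n ∈ N.carrier ∧ n ≠ 0 ∧
    ∀ a ∈ N.carrier, ∀ b ∈ N.carrier, a ≠ 0 → b ≠ 0 → a + b ≠ n}

theorem closure_minGens : AddSubmonoid.closure N.minGens = N.carrier := by
  apply le_antisymm
  · exact AddSubmonoid.closure_le.2 fun n hn => hn.1
  · intro n
    induction n using Nat.strong_induction_on with
    | _ n ih =>
      intro hn
      by_cases h0 : n = 0
      · subst h0; exact zero_mem _
      by_cases h : n ∈ N.minGens
      · exact AddSubmonoid.subset_closure h
      · simp only [minGens, Set.mem_ofPred_eq, not_and, not_forall, not_not] at h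
        obtain ⟨a, ha, b, hb, ha0, hb0, hab⟩ := h hn h0
        rw [← hab]
        exact add_mem (ih a (by omega) ha) (ih b (by omega) hb)

theorem minGens_subset (G : Set ℕ) (hG : AddSubmonoid.closure G = N.carrier) :
    N.minGens ⊆ G := by
  intro n hn
  have key : ∀ m ∈ AddSubmonoid.closure G, m ∈ N.minGens → m ∈ G := by
    intro m hm
    induction hm using AddSubmonoid.closure_induction with
    | mem x hx => exact fun _ => hx
    | zero => exact fun h => absurd rfl h.2.1
    | add x y hx hy ihx ihy =>
      intro h
      by_cases hx0 : x = 0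
      · subst hx0; simpa using ihy (by simpa using h)
      by_cases hy0 : y = 0
      · subst hy0; simpa using ihx (by simpa using h)
      exact absurd rfl (h.2.2 x (hG ▸ hx) y (hG ▸ hy) hx0 hy0)
  exact key n (hG ▸ hn.1) hn

theorem finite_minGens : N.minGens.Finite := by
  obtain ⟨m, hm, hm0⟩ : ∃ m ∈ N.carrier, m ≠ 0 := by
    by_contra! h
    refine (Set.Ioi_infinite (0 : ℕ)) (N.finite_compl.subset fun x hx hxN => ?_)
    exact absurd (h x hxN) (Nat.pos_iff_ne_zero.1 hx)
  have aux : ∀ x ∈ N.minGens, ∀ y ∈ N.minGens, x % m = y % m → x ≤ y := by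
    intro x hx y hy hxy
    by_contra! hlt
    obtain ⟨q, hq⟩ := (Nat.modEq_iff_dvd' hlt.le).1 (show y ≡ x [MOD m] from hxy.symm)
    have hq0 : m * q ≠ 0 := by omega
    refine hx.2.2 y hy.1 (m * q) ?_ hy.2.1 hq0 (by omega)
    rw [mul_comm, ← smul_eq_mul]
    exact nsmul_mem hm q
  refine Set.Finite.of_finite_image (f := (· % m)) ((Set.finite_Iio m).subset ?_) ?_
  · rintro _ ⟨x, -, rfl⟩
    exact Nat.mod_lt _ (Nat.pos_of_ne_zero hm0)
  · exact fun x hx y hy h => le_antisymm (aux x hx y hy h) (aux y hy x hx h.symm)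

/-- The effective weight: the sum over the gaps `ℓ` of the number of minimal generators
smaller than `ℓ`. -/
def effectiveWeight : ℕ := ∑ l ∈ N.gaps, {n ∈ N.minGens | n < l}.ncard

/-- `End(N)`: the natural numbers `n` with `n + (N ∖ 0) ⊆ N`. -/
def endo : Set ℕ := {n | ∀ m ∈ N.carrier, m ≠ 0 → n + m ∈ N.carrier}

/-- `λ(N)`: the number of elements of `End(N) ∖ N`. -/
def lambda : ℕ := (N.endo \ (N.carrier : Set ℕ)).ncard

theorem finite_compl_endo : (N.endoᶜ).Finite :=
  N.finite_compl.subset fun _ hn hN => hn fun _ hm _ => add_mem hN hm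

end NumericalSemigroup

/-- The module `T¹` of an `R`-algebra `S`, computed from an extension `0 → I → P → S → 0` with
`P` a polynomial ring: the first cohomology of the dual of the cotangent complex, i.e. the
cokernel of `Hom_S(Ω_{P/R} ⊗_P S, S) → Hom_S(I/I², S)`. -/
abbrev Algebra.Extension.T1 {R S : Type*} [CommRing R] [CommRing S] [Algebra R S]
    (P : Algebra.Extension R S) : Type _ :=
  Module.Dual S P.Cotangent ⧸ LinearMap.range P.cotangentComplex.dualMap

namespace NumericalSemigroup

variable (N : NumericalSemigroup) (k : Type*) [Field k]

/-- The semigroup algebra `k[N] = ⨁_{n ∈ N} k tⁿ`. -/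
abbrev SemigroupAlgebra : Type _ := AddMonoidAlgebra k N.carrier

/-- The monomial `tⁿ` for a minimal generator `n`. -/
def genMonomial (n : N.minGens) : N.SemigroupAlgebra k :=
  AddMonoidAlgebra.single ⟨n, n.2.1⟩ 1

theorem aeval_genMonomial_surjective :
    Function.Surjective (MvPolynomial.aeval (R := k) (N.genMonomial k)) := by
  rw [← AlgHom.range_eq_top, eq_top_iff]
  have key : ∀ n (hn : n ∈ AddSubmonoid.closure N.minGens) (hn' : n ∈ N.carrier),
      (AddMonoidAlgebra.single (⟨n, hn'⟩ : N.carrier) 1 : N.SemigroupAlgebra k) ∈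
        (MvPolynomial.aeval (R := k) (N.genMonomial k)).range := by
    intro n hn
    induction hn using AddSubmonoid.closure_induction with
    | mem x hx =>
      intro _
      exact ⟨MvPolynomial.X ⟨x, hx⟩, by simp [genMonomial]⟩
    | zero => intro _; exact one_mem _
    | add x y hx hy ihx ihy =>
      intro hxy
      rw [N.closure_minGens] at hx hy
      have := mul_mem (ihx hx) (ihy hy)
      rw [AddMonoidAlgebra.single_mul_single, one_mul] at this
      exact this
  intro f _
  induction f using AddMonoidAlgebra.induction_linear with
  | zero => exact zero_mem _
  | add f g hf hg => exact add_mem (hf trivial) (hg trivial)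
  | single n c =>
    have := Subalgebra.smul_mem _ (key n.1 (by rw [N.closure_minGens]; exact n.2) n.2) c
    simpa using this

/-- The presentation `k[X_n : n a minimal generator] → k[N]`, `X_n ↦ tⁿ`. -/
def presentation : Algebra.Generators k (N.SemigroupAlgebra k) N.minGens :=
  Algebra.Generators.ofSurjective (N.genMonomial k) (N.aeval_genMonomial_surjective k)

/-- The weights of the variables: `X_n` has weight `n`. -/
def varWeight (n : N.minGens) : ℕ := n

/-- The module `T¹(k[N])`. -/
abbrev T1 : Type _ := (N.presentation k).toExtension.T1

/-- The homogeneous component of degree `m` of `k[N]`: it is `k tᵐ` if `m ∈ N`, and `0`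
otherwise. -/
def algebraDegree (m : ℤ) : Submodule k (N.SemigroupAlgebra k) :=
  AddMonoidAlgebra.gradeBy k (fun n : N.carrier => ((n : ℕ) : ℤ)) m

/-- The homomorphisms `I/I² → k[N]` that are homogeneous of degree `l`, where `I` is the kernel of
the presentation: the class of a weighted homogeneous element of `I` of weight `d` is sent to the
component of degree `d + l` of `k[N]`. -/
def homDegree (l : ℤ) :
    Submodule k (Module.Dual (N.SemigroupAlgebra k) (N.presentation k).toExtension.Cotangent) where
  carrier := {φ | ∀ (d : ℕ) (F : MvPolynomial N.minGens k)
    (hF : F ∈ (N.presentation k).toExtension.ker),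
    F.IsWeightedHomogeneous N.varWeight d →
      φ (Algebra.Extension.Cotangent.mk ⟨F, hF⟩) ∈ N.algebraDegree k (d + l)}
  add_mem' hφ hψ d F hF hd := add_mem (hφ d F hF hd) (hψ d F hF hd)
  zero_mem' _ _ _ _ := zero_mem _
  smul_mem' c _ hφ d F hF hd := Submodule.smul_mem _ c (hφ d F hF hd)

/-- The graded piece `T¹(k[N])_l`. -/
def T1Degree (l : ℤ) : Submodule k (N.T1 k) :=
  (N.homDegree k l).map
    ((LinearMap.range (N.presentation k).toExtension.cotangentComplex.dualMap).mkQ.restrictScalars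
      k)

/-- The positive graded part `T^{1,+}(k[N])`, spanned by the graded pieces of positive degree. -/
def T1Pos : Submodule k (N.T1 k) := ⨆ (l : ℤ) (_ : 0 < l), N.T1Degree k l

/-- A set of pairs of exponents `(α, β)` such that the binomials `X^α - X^β` are isobaric, have
`α` and `β` of disjoint support, and generate the kernel of the presentation of `k[N]`. -/
structure IsBinomialSystem (S : Set ((N.minGens →₀ ℕ) × (N.minGens →₀ ℕ))) : Prop where
  isobaric : ∀ p ∈ S, Finsupp.weight N.varWeight p.1 = Finsupp.weight N.varWeight p.2
  disjoint : ∀ p ∈ S, Disjoint p.1.support p.2.support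
  span_eq : Ideal.span
      ((fun p => MvPolynomial.monomial p.1 (1 : k) - MvPolynomial.monomial p.2 (1 : k)) '' S) =
    RingHom.ker (MvPolynomial.aeval (R := k) (N.genMonomial k))

/-- The space `V_l ⊆ k^r` (with `r` the number of minimal generators): the span of the vectors
`α - β` for those binomials `X^α - X^β` of the system whose weight `d` satisfies `d + l ∉ N`. -/
def V (S : Set ((N.minGens →₀ ℕ) × (N.minGens →₀ ℕ))) (l : ℕ) : Submodule k (N.minGens → k) :=
  Submodule.span k
    ((fun p n => (p.1 n : k) - (p.2 n : k)) ''
      {p ∈ S | Finsupp.weight N.varWeight p.1 + l ∉ N.carrier})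

end NumericalSemigroup

end

noncomputable section

/-! ### Weights, monomials of `k[N]`, and the toric ideal. -/

namespace NumericalSemigroup

open MvPolynomial

variable (N : NumericalSemigroup) (k : Type*) [Field k]

/-! Each graded piece of `T¹` of degree `l ≥ 0` is a quotient of spaces of vectors `a ∈ k^r`. A
homomorphism `I/I² → k[N]` of degree `l` sends an isobaric binomial of weight `d` to a multiple of
`t^(d+l)`. Setting `t = 1` turns it into an additive function of `α - β`, and in characteristic zero
such a function is the pairing with some `a` (`exists_evalBinom_eq`), unique up to multiples of
`(n₁, …, n_r)` (`mem_span_genVec`). The vectors that occur are those with `a · (α - β) = 0` whenever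
`d + l ∉ N` (`shiftDeriv_mul`, `exists_eq_shiftHom`). Checking this on generators of `I` suffices,
so they form the orthogonal of `V_l`, of dimension `r - dim V_l` (`finrank_annihilator_add`).

The derivation `X_j ↦ a_j t^(n_j + l)` requires `a_j = 0` when `n_j + l ∉ N`. The trivial vectors
are these together with the line of `(n₁, …, n_r)`. For `l ∈ End(N)` they are everything and `T¹_l =
0`; otherwise the sum is direct and `dim T¹_l = #{j : n_j + l ∉ N} - 1 - dim V_l`. Summing over `l ∉
End(N)`, the first term gives `ewt(N)` by `(l, j) ↦ (n_j + l, j)`, and there are `g - λ(N)` such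
`l`. -/

instance instFintypeMinGens : Fintype N.minGens := N.finite_minGens.fintype

theorem nonempty_minGens : Nonempty N.minGens := by
  by_contra h
  have h0 : N.minGens = ∅ := Set.not_nonempty_iff_eq_empty.1 fun ⟨x, hx⟩ => h ⟨⟨x, hx⟩⟩
  have hbot := N.closure_minGens
  rw [h0, AddSubmonoid.closure_empty] at hbot
  refine (Set.Ioi_infinite (0 : ℕ)) (N.finite_compl.subset fun x hx hxN => ?_)
  rw [← hbot] at hxN
  exact absurd hxN (Nat.pos_iff_ne_zero.1 hx)

/-- A nonzero element of `N` is a generator plus an element of `N`, so generators suffice. For `l ∉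
End(N)` this provides a `j` with `n_j + l ∉ N`. -/
theorem mem_endo_iff (l : ℕ) : l ∈ N.endo ↔ ∀ j : N.minGens, (j : ℕ) + l ∈ N.carrier := by
  refine ⟨fun h j => by rw [add_comm]; exact h j j.2.1 j.2.2.1, fun h m hm hm0 => ?_⟩
  have key : ∀ m ∈ AddSubmonoid.closure N.minGens, m ≠ 0 → l + m ∈ N.carrier := by
    intro m hm
    induction hm using AddSubmonoid.closure_induction with
    | mem x hx => intro _; rw [add_comm]; exact h ⟨x, hx⟩
    | zero => exact fun h => absurd rfl h
    | add x y hx hy ihx ihy =>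
      intro _
      rw [N.closure_minGens] at hx hy
      by_cases hx0 : x = 0
      · subst hx0
        by_cases hy0 : y = 0
        · omega
        · simpa using ihy hy0
      · rw [← add_assoc]
        exact add_mem (ihx hx0) hy
  exact key m (by rwa [N.closure_minGens]) hm0

/-- The weight of a monomial. -/
abbrev deg (α : N.minGens →₀ ℕ) : ℕ := Finsupp.weight N.varWeight α

theorem deg_add (α β : N.minGens →₀ ℕ) : N.deg (α + β) = N.deg α + N.deg β := map_add _ _ _

theorem deg_mem (α : N.minGens →₀ ℕ) : N.deg α ∈ N.carrier := by
  rw [deg, Finsupp.weight_eq_sum]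
  exact sum_mem fun i _ => nsmul_mem i.2.1 _

theorem deg_add_mem {α : N.minGens →₀ ℕ} {j : N.minGens} (hj : α j ≠ 0) {l : ℕ}
    (h : (j : ℕ) + l ∈ N.carrier) : N.deg α + l ∈ N.carrier := by
  have := Finsupp.weight_sub_single_add (w := N.varWeight) hj
  rw [deg, ← this, add_assoc]
  exact add_mem (N.deg_mem _) h

open Classical in
/-- The monomial `tᵐ` of `k[N]`, and `0` if `m ∉ N`. -/
def mono (m : ℕ) : N.SemigroupAlgebra k :=
  if h : m ∈ N.carrier then AddMonoidAlgebra.single ⟨m, h⟩ 1 else 0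

theorem mono_of_mem {m : ℕ} (h : m ∈ N.carrier) :
    N.mono k m = AddMonoidAlgebra.single ⟨m, h⟩ 1 := dif_pos h

theorem mono_of_notMem {m : ℕ} (h : m ∉ N.carrier) : N.mono k m = 0 := dif_neg h

theorem mono_mul_mono {e m : ℕ} (he : e ∈ N.carrier) (hm : m ∈ N.carrier) :
    N.mono k e * N.mono k m = N.mono k (e + m) := by
  rw [N.mono_of_mem k he, N.mono_of_mem k hm, N.mono_of_mem k (add_mem he hm),
    AddMonoidAlgebra.single_mul_single, one_mul]
  rfl

open Classical in
/-- The coefficient of `tᵐ`, which is `0` if `m ∉ N`. -/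
def coeffAt (m : ℕ) : N.SemigroupAlgebra k →ₗ[k] k :=
  if h : m ∈ N.carrier then
    Finsupp.lapply ⟨m, h⟩ ∘ₗ (AddMonoidAlgebra.coeffLinearEquiv k).toLinearMap
  else 0

theorem coeffAt_of_mem {m : ℕ} (h : m ∈ N.carrier) (x : N.SemigroupAlgebra k) :
    N.coeffAt k m x = x.coeff ⟨m, h⟩ := by
  rw [coeffAt, dif_pos h]; rfl

theorem coeffAt_of_notMem {m : ℕ} (h : m ∉ N.carrier) (x : N.SemigroupAlgebra k) :
    N.coeffAt k m x = 0 := by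
  rw [coeffAt, dif_neg h]; rfl

theorem coeffAt_mono {m n : ℕ} (hn : n ∈ N.carrier) :
    N.coeffAt k m (N.mono k n) = if n = m then 1 else 0 := by
  by_cases h : m ∈ N.carrier
  · rw [N.coeffAt_of_mem k h, N.mono_of_mem k hn, AddMonoidAlgebra.coeff_single,
      Finsupp.single_apply]
    simp
  · rw [N.coeffAt_of_notMem k h, if_neg]
    rintro rfl
    exact h hn

variable {k} in
theorem ext_coeffAt {x y : N.SemigroupAlgebra k}
    (h : ∀ m, N.coeffAt k m x = N.coeffAt k m y) : x = y := by
  ext n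
  have := h n
  rwa [N.coeffAt_of_mem k n.2, N.coeffAt_of_mem k n.2] at this

variable {k} in
theorem mono_induction {p : N.SemigroupAlgebra k → Prop} (zero : p 0)
    (add : ∀ x y, p x → p y → p (x + y)) (mono : ∀ n ∈ N.carrier, ∀ c : k, p (c • N.mono k n))
    (x : N.SemigroupAlgebra k) : p x := by
  induction x using AddMonoidAlgebra.induction_linear with
  | zero => exact zero
  | add f g hf hg => exact add f g hf hg
  | single n c =>
    have := mono n n.2 c
    rw [N.mono_of_mem k n.2] at this
    simpa using this

theorem coeffAt_mono_mul {e m : ℕ} (he : e ∈ N.carrier) (x : N.SemigroupAlgebra k) :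
    N.coeffAt k (e + m) (N.mono k e * x) = N.coeffAt k m x := by
  induction x using N.mono_induction with
  | zero => simp
  | add x y hx hy => rw [mul_add, map_add, map_add, hx, hy]
  | mono n hn c =>
    rw [mul_smul_comm, map_smul, map_smul, N.mono_mul_mono k he hn,
      N.coeffAt_mono k (add_mem he hn), N.coeffAt_mono k hn]
    simp

/-- The evaluation `k[N] → k` at `t = 1`. -/
def evalOne : N.SemigroupAlgebra k →ₐ[k] k := AddMonoidAlgebra.lift k k N.carrier 1

theorem evalOne_mono {m : ℕ} (hm : m ∈ N.carrier) : N.evalOne k (N.mono k m) = 1 := by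
  rw [N.mono_of_mem k hm, evalOne, AddMonoidAlgebra.lift_single]
  simp

theorem mono_mem_algebraDegree (m : ℕ) : N.mono k m ∈ N.algebraDegree k m := by
  by_cases h : m ∈ N.carrier
  · rw [N.mono_of_mem k h]
    exact AddMonoidAlgebra.single_mem_gradeBy (fun n : N.carrier => ((n : ℕ) : ℤ)) ⟨m, h⟩ (1 : k)
  · rw [N.mono_of_notMem k h]
    exact zero_mem _

-- Graded components of `k[N]` have dimension at most one, so evaluation at `t = 1` loses nothing on
-- them. For `m ∉ N` both sides vanish.
variable {k} in
theorem eq_evalOne_smul_mono {x : N.SemigroupAlgebra k} {m : ℕ} (hx : x ∈ N.algebraDegree k m) :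
    x = N.evalOne k x • N.mono k m := by
  have hx' : ∀ n : N.carrier, (n : ℕ) ≠ m → x.coeff n = 0 := fun n hn => by
    by_contra h
    exact hn (Nat.cast_injective (R := ℤ) (hx n (Finsupp.mem_support_iff.2 h)))
  obtain ⟨c, hc⟩ : ∃ c : k, x = c • N.mono k m := by
    refine ⟨N.coeffAt k m x, N.ext_coeffAt fun i => ?_⟩
    rw [map_smul]
    by_cases hi : i ∈ N.carrier
    · by_cases him : i = m
      · subst him
        rw [N.coeffAt_mono k hi]
        simp
      · rw [N.coeffAt_of_mem k hi x, hx' ⟨i, hi⟩ him]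
        by_cases hm : m ∈ N.carrier
        · rw [N.coeffAt_mono k hm, if_neg (Ne.symm him), smul_zero]
        · rw [N.mono_of_notMem k hm]; simp
    · rw [N.coeffAt_of_notMem k hi, N.coeffAt_of_notMem k hi, smul_zero]
  by_cases hm : m ∈ N.carrier
  · rw [hc, map_smul, N.evalOne_mono k hm]
    simp
  · rw [hc, N.mono_of_notMem k hm]; simp

/-- The homomorphism `k[X] → k[N]`. -/
abbrev toAlg : MvPolynomial N.minGens k →ₐ[k] N.SemigroupAlgebra k :=
  MvPolynomial.aeval (N.genMonomial k)

theorem toAlg_monomial (α : N.minGens →₀ ℕ) :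
    N.toAlg k (monomial α 1) = N.mono k (N.deg α) := by
  induction α using Finsupp.induction_linear with
  | zero =>
    rw [deg, map_zero, N.mono_of_mem k (zero_mem _)]
    exact map_one _
  | add α β hα hβ =>
    rw [deg, map_add, ← N.mono_mul_mono k (N.deg_mem α) (N.deg_mem β), ← hα, ← hβ, ← map_mul,
      monomial_mul, one_mul]
  | single j n =>
    rw [← X_pow_eq_monomial, map_pow, aeval_X, deg, Finsupp.weight_single, smul_eq_mul,
      N.mono_of_mem k (by rw [← smul_eq_mul]; exact nsmul_mem j.2.1 _), genMonomial,
      AddMonoidAlgebra.single_pow, one_pow]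
    congr 1

/-- The binomial `X^α - X^β`. -/
abbrev binom (α β : N.minGens →₀ ℕ) : MvPolynomial N.minGens k := monomial α 1 - monomial β 1

theorem toAlg_binom {α β : N.minGens →₀ ℕ} (h : N.deg α = N.deg β) :
    N.toAlg k (N.binom k α β) = 0 := by
  rw [map_sub, N.toAlg_monomial, N.toAlg_monomial, h, sub_self]

variable {k} in
/-- The toric ideal is spanned by isobaric binomials as a vector space. -/
theorem mem_span_binom {F : MvPolynomial N.minGens k} (hF : N.toAlg k F = 0) :
    F ∈ Submodule.span k {G | ∃ α β, N.deg α = N.deg β ∧ G = N.binom k α β} := by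
  -- `s` is a linear section of `toAlg`, sending `tⁿ` to a chosen monomial of weight `n`.
  -- Subtracting `s (toAlg F)` replaces each monomial of `F` by a binomial and changes nothing when
  -- `F ∈ I`.
  let s : N.SemigroupAlgebra k →ₗ[k] MvPolynomial N.minGens k :=
    Finsupp.lsum k (fun n : N.carrier => monomial (Function.invFun N.deg n)) ∘ₗ
      (AddMonoidAlgebra.coeffLinearEquiv k).toLinearMap
  have hs : ∀ α, s (N.mono k (N.deg α)) = monomial (Function.invFun N.deg (N.deg α)) 1 := by
    intro α
    rw [N.mono_of_mem k (N.deg_mem α)]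
    change (Finsupp.lsum k _) (Finsupp.single _ _) = _
    simp
  have key : ∀ F : MvPolynomial N.minGens k, F - s (N.toAlg k F) ∈
      Submodule.span k {G | ∃ α β, N.deg α = N.deg β ∧ G = N.binom k α β} := by
    intro F
    induction F using MvPolynomial.induction_on' with
    | monomial α c =>
      have h1 : monomial α c = c • (monomial α 1 : MvPolynomial N.minGens k) := by
        rw [smul_monomial, smul_eq_mul, mul_one]
      rw [h1, map_smul, map_smul, ← smul_sub, N.toAlg_monomial, hs]
      refine Submodule.smul_mem _ _ (Submodule.subset_span ⟨_, _, ?_, rfl⟩)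
      exact (Function.invFun_eq (f := N.deg) ⟨α, rfl⟩).symm
    | add p q hp hq =>
      rw [map_add, map_add, add_sub_add_comm]
      exact add_mem hp hq
  simpa [hF] using key F

end NumericalSemigroup

/-! ### Homomorphisms `I/I² → k[N]` attached to vectors, and coefficients of derivations. -/

namespace NumericalSemigroup

open MvPolynomial

variable (N : NumericalSemigroup) (k : Type*) [Field k]

/-- The vectors `a` orthogonal to `α - β` for all isobaric binomials `X^α - X^β` whose weight `d`
satisfies `d + l ∉ N`. -/
def annihilator (l : ℕ) : Submodule k (N.minGens → k) where
  carrier := {a | ∀ α β, N.deg α = N.deg β → N.deg α + l ∉ N.carrier →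
    Finsupp.weight a α = Finsupp.weight a β}
  add_mem' {a b} ha hb α β h hl := by
    have h1 := ha α β h hl
    have h2 := hb α β h hl
    simp only [Finsupp.weight_eq_sum] at h1 h2 ⊢
    simp only [Pi.add_apply, smul_add, Finset.sum_add_distrib, h1, h2]
  zero_mem' α β _ _ := by simp [Finsupp.weight_eq_sum]
  smul_mem' c a ha α β h hl := by
    have h1 := ha α β h hl
    simp only [Finsupp.weight_eq_sum] at h1 ⊢
    simp only [Pi.smul_apply, smul_comm _ c, ← Finset.smul_sum, h1]

/-- The linear map `X^α ↦ (a · α) t^(wt(α) + l)`, with `tᵐ` read as `0` if `m ∉ N`. -/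
def shiftDeriv (a : N.minGens → k) (l : ℕ) :
    MvPolynomial N.minGens k →ₗ[k] N.SemigroupAlgebra k :=
  (basisMonomials N.minGens k).constr k fun α => Finsupp.weight a α • N.mono k (N.deg α + l)

variable {k}

theorem shiftDeriv_monomial (a : N.minGens → k) (l : ℕ) (α : N.minGens →₀ ℕ) :
    N.shiftDeriv k a l (monomial α 1) = Finsupp.weight a α • N.mono k (N.deg α + l) := by
  have := (basisMonomials N.minGens k).constr_basis k
    (fun α => Finsupp.weight a α • N.mono k (N.deg α + l)) α
  rwa [coe_basisMonomials] at this

theorem shiftDeriv_add (a b : N.minGens → k) (l : ℕ) :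
    N.shiftDeriv k (a + b) l = N.shiftDeriv k a l + N.shiftDeriv k b l := by
  refine (basisMonomials N.minGens k).ext fun α => ?_
  rw [coe_basisMonomials, LinearMap.add_apply]
  simp only [shiftDeriv_monomial, ← add_smul]
  congr 1
  simp [Finsupp.weight_eq_sum, Finset.sum_add_distrib]

theorem shiftDeriv_smul (c : k) (a : N.minGens → k) (l : ℕ) :
    N.shiftDeriv k (c • a) l = c • N.shiftDeriv k a l := by
  refine (basisMonomials N.minGens k).ext fun α => ?_
  rw [coe_basisMonomials, LinearMap.smul_apply]
  simp only [shiftDeriv_monomial, smul_smul]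
  congr 1
  simp [Finsupp.weight_eq_sum, Finset.mul_sum, mul_left_comm]

theorem shiftDeriv_binom (a : N.minGens → k) (l : ℕ) {α β : N.minGens →₀ ℕ}
    (h : N.deg α = N.deg β) :
    N.shiftDeriv k a l (N.binom k α β) =
      (Finsupp.weight a α - Finsupp.weight a β) • N.mono k (N.deg α + l) := by
  rw [map_sub, shiftDeriv_monomial, shiftDeriv_monomial, ← h, sub_smul]

theorem monomial_mul_binom (γ α β : N.minGens →₀ ℕ) :
    monomial γ (1 : k) * N.binom k α β = N.binom k (γ + α) (γ + β) := by
  rw [mul_sub, monomial_mul, monomial_mul, one_mul]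

/-- Linearity on `I` can only fail when `t^(d+l)` is read as `0` while a multiple of it by `X^γ` is
not; the condition defining `annihilator` makes the coefficient vanish exactly there. -/
theorem shiftDeriv_mul {a : N.minGens → k} {l : ℕ} (ha : a ∈ N.annihilator k l)
    (p : MvPolynomial N.minGens k) {F : MvPolynomial N.minGens k} (hF : N.toAlg k F = 0) :
    N.shiftDeriv k a l (p * F) = N.toAlg k p * N.shiftDeriv k a l F := by
  induction p using MvPolynomial.induction_on' with
  | add p q hp hq => rw [add_mul, map_add, hp, hq, map_add, add_mul]
  | monomial γ c =>
    have h1 : monomial γ c = c • (monomial γ 1 : MvPolynomial N.minGens k) := by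
      rw [smul_monomial, smul_eq_mul, mul_one]
    rw [h1, smul_mul_assoc, map_smul, map_smul, smul_mul_assoc]
    congr 1
    have hF' := N.mem_span_binom hF
    clear hF
    induction hF' using Submodule.span_induction with
    | zero => simp
    | add x y _ _ hx hy => rw [mul_add, map_add, map_add, mul_add, hx, hy]
    | smul c x _ hx => rw [mul_smul_comm, map_smul, map_smul, mul_smul_comm, hx]
    | mem x hx =>
      obtain ⟨α, β, h, rfl⟩ := hx
      rw [monomial_mul_binom, N.shiftDeriv_binom a l h, N.toAlg_monomial,
        N.shiftDeriv_binom a l (by rw [N.deg_add, N.deg_add, h]), map_add, map_add,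
        add_sub_add_left_eq_sub, mul_smul_comm]
      by_cases hl : N.deg α + l ∈ N.carrier
      · rw [N.mono_mul_mono k (N.deg_mem γ) hl, N.deg_add γ α, add_assoc]
      · rw [ha α β h hl, sub_self, zero_smul, zero_smul]

variable (k)

/-- The class in `I/I²` of an element of `I`. -/
def idealClass (F : MvPolynomial N.minGens k) (hF : N.toAlg k F = 0) :
    (N.presentation k).toExtension.Cotangent :=
  Algebra.Extension.Cotangent.mk ⟨F, hF⟩

variable {k}

theorem idealClass_add {F G : MvPolynomial N.minGens k} (hF : N.toAlg k F = 0)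
    (hG : N.toAlg k G = 0) (hFG : N.toAlg k (F + G) = 0) :
    N.idealClass k (F + G) hFG = N.idealClass k F hF + N.idealClass k G hG :=
  (Algebra.Extension.Cotangent.mk (P := (N.presentation k).toExtension)).map_add ⟨F, hF⟩ ⟨G, hG⟩

theorem idealClass_mul (p : MvPolynomial N.minGens k) {F : MvPolynomial N.minGens k}
    (hF : N.toAlg k F = 0) (hpF : N.toAlg k (p * F) = 0) :
    N.idealClass k (p * F) hpF = N.toAlg k p • N.idealClass k F hF :=
  ((Algebra.Extension.Cotangent.mk (P := (N.presentation k).toExtension)).map_smul p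
    ⟨F, hF⟩).trans (algebraMap_smul (R := (N.presentation k).toExtension.Ring)
      (N.SemigroupAlgebra k) p (N.idealClass k F hF)).symm

variable (k)

/-- The class of a binomial in `I/I²`. -/
def binomClass {α β : N.minGens →₀ ℕ} (h : N.deg α = N.deg β) :
    (N.presentation k).toExtension.Cotangent :=
  N.idealClass k (N.binom k α β) (N.toAlg_binom k h)

variable {k}

theorem dual_ext_binom {φ ψ : Module.Dual (N.SemigroupAlgebra k)
    (N.presentation k).toExtension.Cotangent}
    (h : ∀ α β (hαβ : N.deg α = N.deg β),
      φ (N.binomClass k hαβ) = ψ (N.binomClass k hαβ)) : φ = ψ := by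
  have hker : ∀ x ∈ Submodule.span k {G | ∃ α β, N.deg α = N.deg β ∧ G = N.binom k α β},
      N.toAlg k x = 0 := fun x hx => by
    refine (Submodule.span_le (p := LinearMap.ker (N.toAlg k).toLinearMap)).2 ?_ hx
    rintro _ ⟨α, β, h, rfl⟩
    exact N.toAlg_binom k h
  have key : ∀ F (_ : F ∈ Submodule.span k {G | ∃ α β, N.deg α = N.deg β ∧ G = N.binom k α β})
      (hF : N.toAlg k F = 0), φ (N.idealClass k F hF) = ψ (N.idealClass k F hF) := by
    intro F hF
    have hC : ∀ (c : k) (x : MvPolynomial N.minGens k) (hx : N.toAlg k x = 0)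
        (hcx : N.toAlg k (c • x) = 0), φ (N.idealClass k x hx) = ψ (N.idealClass k x hx) →
        φ (N.idealClass k (c • x) hcx) = ψ (N.idealClass k (c • x) hcx) := by
      intro c x hx
      rw [smul_eq_C_mul]
      intro hcx hφ
      rw [N.idealClass_mul _ hx, map_smul, map_smul, hφ]
    induction hF using Submodule.span_induction with
    | mem x hx =>
      obtain ⟨α, β, hαβ, rfl⟩ := hx
      exact fun _ => h α β hαβ
    | zero =>
      intro h0
      have h1 : N.idealClass k 0 h0 = 0 :=
        (Algebra.Extension.Cotangent.mk (P := (N.presentation k).toExtension)).map_zero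
      rw [h1, map_zero, map_zero]
    | add x y hx hy ihx ihy =>
      intro hxy
      rw [N.idealClass_add (hker x hx) (hker y hy), map_add, map_add, ihx, ihy]
    | smul c x hx ihx => exact fun hcx => hC c x (hker x hx) hcx (ihx _)
  refine LinearMap.ext fun x => ?_
  obtain ⟨⟨F, hF⟩, rfl⟩ := Algebra.Extension.Cotangent.mk_surjective x
  exact key F (N.mem_span_binom hF) hF

/-- The homomorphism `I/I² → k[N]` of degree `l` attached to a vector `a`. -/
def shiftHom {a : N.minGens → k} {l : ℕ} (ha : a ∈ N.annihilator k l) :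
    Module.Dual (N.SemigroupAlgebra k) (N.presentation k).toExtension.Cotangent :=
  let f : (N.presentation k).toExtension.ker →ₗ[(N.presentation k).toExtension.Ring]
      N.SemigroupAlgebra k :=
    { toFun := fun x => N.shiftDeriv k a l x.1
      map_add' := fun x y => map_add (N.shiftDeriv k a l) x.1 y.1
      map_smul' := fun p x => N.shiftDeriv_mul ha p x.2 }
  let g : (N.presentation k).toExtension.Cotangent →ₗ[(N.presentation k).toExtension.Ring]
      N.SemigroupAlgebra k :=
    (Ideal.Cotangent.lift f fun x y => by
      -- For `x, y ∈ I` linearity gives the factor `toAlg x = 0`, so `I²` is killed.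
      refine (N.shiftDeriv_mul ha x.1 y.2).trans ?_
      rw [show N.toAlg k x.1 = 0 from x.2, zero_mul]) ∘ₗ
        (N.presentation k).toExtension.cotangentEquivCotangentKer.toLinearMap
  LinearMap.extendScalarsOfSurjective (N.presentation k).toExtension.algebraMap_surjective g

theorem shiftHom_idealClass {a : N.minGens → k} {l : ℕ} (ha : a ∈ N.annihilator k l)
    (F : MvPolynomial N.minGens k) (hF : N.toAlg k F = 0) :
    N.shiftHom ha (N.idealClass k F hF) = N.shiftDeriv k a l F := rfl

theorem shiftHom_binomClass {a : N.minGens → k} {l : ℕ} (ha : a ∈ N.annihilator k l)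
    {α β : N.minGens →₀ ℕ} (h : N.deg α = N.deg β) :
    N.shiftHom ha (N.binomClass k h) =
      (Finsupp.weight a α - Finsupp.weight a β) • N.mono k (N.deg α + l) :=
  N.shiftDeriv_binom a l h

theorem shiftHom_mem_homDegree {a : N.minGens → k} {l : ℕ} (ha : a ∈ N.annihilator k l) :
    N.shiftHom ha ∈ N.homDegree k l := by
  intro d F hF hd
  change N.shiftDeriv k a l F ∈ _
  rw [F.as_sum, map_sum]
  refine sum_mem fun α hα => ?_
  have h1 : monomial α (F.coeff α) =
      (F.coeff α) • (monomial α 1 : MvPolynomial N.minGens k) := by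
    rw [smul_monomial, smul_eq_mul, mul_one]
  rw [h1, map_smul, shiftDeriv_monomial]
  have h2 : N.deg α = d := hd (mem_support_iff.1 hα)
  rw [h2]
  have := N.mono_mem_algebraDegree k (d + l)
  rw [Nat.cast_add] at this
  exact Submodule.smul_mem _ _ (Submodule.smul_mem _ _ this)

theorem apply_cotangentComplex_binomClass (θ : Module.Dual (N.SemigroupAlgebra k)
    (N.presentation k).toExtension.CotangentSpace) {α β : N.minGens →₀ ℕ}
    (h : N.deg α = N.deg β) :
    θ ((N.presentation k).toExtension.cotangentComplex (N.binomClass k h)) =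
      ∑ j, N.toAlg k (pderiv j (N.binom k α β)) * θ ((N.presentation k).cotangentSpaceBasis j) := by
  rw [binomClass, idealClass, Algebra.Extension.cotangentComplex_mk]
  conv_lhs => rw [← (N.presentation k).cotangentSpaceBasis.sum_repr (1 ⊗ₜ _), map_sum]
  refine Finset.sum_congr rfl fun j _ => ?_
  rw [map_smul, smul_eq_mul]
  congr 1
  exact (N.presentation k).cotangentSpaceBasis_repr_one_tmul (N.binom k α β) j

theorem toAlg_pderiv_monomial (α : N.minGens →₀ ℕ) (j : N.minGens) :
    N.toAlg k (pderiv j (monomial α 1)) =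
      (α j : k) • N.mono k (N.deg (α - Finsupp.single j 1)) := by
  rw [pderiv_monomial, one_mul, ← N.toAlg_monomial, ← map_smul, smul_monomial, smul_eq_mul, mul_one]

theorem coeffAt_toAlg_pderiv_mul (α : N.minGens →₀ ℕ) (j : N.minGens) (l : ℕ)
    (x : N.SemigroupAlgebra k) :
    N.coeffAt k (N.deg α + l) (N.toAlg k (pderiv j (monomial α 1)) * x) =
      α j * N.coeffAt k (j + l) x := by
  rw [toAlg_pderiv_monomial, smul_mul_assoc, map_smul, smul_eq_mul]
  by_cases hj : α j = 0
  · simp [hj]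
  · have : N.deg (α - Finsupp.single j 1) + (j : ℕ) = N.deg α :=
      Finsupp.weight_sub_single_add (w := N.varWeight) hj
    rw [← this, add_assoc, N.coeffAt_mono_mul k (N.deg_mem _)]

/-- Although `θ` need not be homogeneous, this coefficient only sees the coefficients of `t^(n_j +
l)` in `θ(dX_j)`: the degree `l` part of any derivation is described by a vector. -/
theorem coeffAt_apply_cotangentComplex (θ : Module.Dual (N.SemigroupAlgebra k)
    (N.presentation k).toExtension.CotangentSpace) {α β : N.minGens →₀ ℕ}
    (h : N.deg α = N.deg β) (l : ℕ) :
    N.coeffAt k (N.deg α + l)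
      (θ ((N.presentation k).toExtension.cotangentComplex (N.binomClass k h))) =
      Finsupp.weight (fun j : N.minGens =>
        N.coeffAt k (j + l) (θ ((N.presentation k).cotangentSpaceBasis j))) α -
      Finsupp.weight (fun j : N.minGens =>
        N.coeffAt k (j + l) (θ ((N.presentation k).cotangentSpaceBasis j))) β := by
  rw [apply_cotangentComplex_binomClass, map_sum, Finsupp.weight_eq_sum, Finsupp.weight_eq_sum,
    ← Finset.sum_sub_distrib]
  refine Finset.sum_congr rfl fun j _ => ?_
  rw [map_sub, map_sub, sub_mul, map_sub, coeffAt_toAlg_pderiv_mul, h, coeffAt_toAlg_pderiv_mul]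
  simp

end NumericalSemigroup

/-! ### Every homogeneous homomorphism of degree `l ≥ 0` comes from a vector; trivial vectors. -/

namespace NumericalSemigroup

open MvPolynomial

variable (N : NumericalSemigroup) {k : Type*} [Field k]

theorem idealClass_congr {F G : MvPolynomial N.minGens k} (h : F = G) (hF : N.toAlg k F = 0)
    (hG : N.toAlg k G = 0) : N.idealClass k F hF = N.idealClass k G hG := by
  subst h; rfl

section EvalOne

variable (φ : Module.Dual (N.SemigroupAlgebra k) (N.presentation k).toExtension.Cotangent)

/-- The value at `t = 1` of a homomorphism `I/I² → k[N]` on a binomial. -/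
def evalBinom {α β : N.minGens →₀ ℕ} (h : N.deg α = N.deg β) : k :=
  N.evalOne k (φ (N.binomClass k h))

theorem evalBinom_trans {α β γ : N.minGens →₀ ℕ} (h : N.deg α = N.deg β)
    (h' : N.deg β = N.deg γ) :
    N.evalBinom φ (h.trans h') = N.evalBinom φ h + N.evalBinom φ h' := by
  have : N.binomClass k (h.trans h') = N.binomClass k h + N.binomClass k h' := by
    rw [binomClass, binomClass, binomClass, ← N.idealClass_add _ _ (by
      rw [map_add, N.toAlg_binom k h, N.toAlg_binom k h', add_zero])]
    exact N.idealClass_congr (by rw [sub_add_sub_cancel]) _ _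
  rw [evalBinom, this, map_add, map_add, evalBinom, evalBinom]

/-- Multiplication by `X^γ` acts on `k[N]` as a power of `t`, which is `1` at `t = 1`. -/
theorem evalBinom_add_left (γ : N.minGens →₀ ℕ) {α β : N.minGens →₀ ℕ} (h : N.deg α = N.deg β)
    (h' : N.deg (γ + α) = N.deg (γ + β)) : N.evalBinom φ h' = N.evalBinom φ h := by
  have : N.binomClass k h' = N.toAlg k (monomial γ 1) • N.binomClass k h := by
    rw [binomClass, binomClass, ← N.idealClass_mul _ _ (by
      rw [map_mul, N.toAlg_binom k h, mul_zero])]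
    exact N.idealClass_congr (N.monomial_mul_binom γ α β).symm _ _
  rw [evalBinom, this, map_smul, smul_eq_mul, map_mul, N.toAlg_monomial,
    N.evalOne_mono k (N.deg_mem γ), one_mul, evalBinom]

theorem evalBinom_add {α β α' β' : N.minGens →₀ ℕ} (h : N.deg α = N.deg β)
    (h' : N.deg α' = N.deg β') (h'' : N.deg (α + α') = N.deg (β + β')) :
    N.evalBinom φ h'' = N.evalBinom φ h + N.evalBinom φ h' := by
  have h1 : N.deg (α + α') = N.deg (α + β') := by rw [N.deg_add, N.deg_add, h']
  have h2 : N.deg (β' + α) = N.deg (β' + β) := by rw [N.deg_add, N.deg_add, h]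
  have h3 : N.deg (α + β') = N.deg (β + β') := by rw [N.deg_add, N.deg_add, h]
  have e1 := N.evalBinom_trans φ h1 h3
  have e2 := N.evalBinom_add_left φ α h' h1
  have e3 := N.evalBinom_add_left φ β' h h2
  simp only [add_comm β'] at e3
  rw [e1, e2, e3, add_comm]

theorem evalBinom_refl (α : N.minGens →₀ ℕ) : N.evalBinom φ (rfl : N.deg α = N.deg α) = 0 := by
  have := N.evalBinom_trans φ (rfl : N.deg α = N.deg α) rfl
  simpa using this

theorem evalBinom_nsmul {α β : N.minGens →₀ ℕ} (h : N.deg α = N.deg β) (n : ℕ)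
    (h' : N.deg (n • α) = N.deg (n • β)) : N.evalBinom φ h' = n * N.evalBinom φ h := by
  induction n with
  | zero =>
    simp only [zero_smul, Nat.cast_zero, zero_mul]
    exact N.evalBinom_refl φ 0
  | succ n ih =>
    have hn : N.deg (n • α) = N.deg (n • β) := by
      rw [deg, deg, map_nsmul, map_nsmul]
      exact congrArg _ h
    simp only [succ_nsmul]
    rw [N.evalBinom_add φ hn h, ih hn]
    push_cast
    ring

/-- After multiplying exponents by `n_i`, every monomial can be compared with a power of the single
variable `X_i`. -/
theorem deg_nsmul_eq (i : N.minGens) (α : N.minGens →₀ ℕ) :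
    N.deg ((i : ℕ) • α) = N.deg (Finsupp.single i (N.deg α)) := by
  simp only [deg, map_nsmul, Finsupp.weight_single, smul_eq_mul]
  exact mul_comm _ _

theorem evalBinom_nsmul_single (i : N.minGens) (α : N.minGens →₀ ℕ) :
    N.evalBinom φ (N.deg_nsmul_eq i α) =
      Finsupp.weight (fun j => N.evalBinom φ (N.deg_nsmul_eq i (Finsupp.single j 1))) α := by
  have hz : N.evalBinom φ (N.deg_nsmul_eq i 0) = 0 := by
    simp only [deg, map_zero, smul_zero, Finsupp.single_zero]
    exact N.evalBinom_refl φ 0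
  have hadd : ∀ α β, N.evalBinom φ (N.deg_nsmul_eq i (α + β)) =
      N.evalBinom φ (N.deg_nsmul_eq i α) + N.evalBinom φ (N.deg_nsmul_eq i β) := by
    intro α β
    rw [← N.evalBinom_add φ (N.deg_nsmul_eq i α) (N.deg_nsmul_eq i β) (by
      rw [N.deg_add, N.deg_add, N.deg_nsmul_eq, N.deg_nsmul_eq])]
    simp only [smul_add, N.deg_add, Finsupp.single_add]
  let g : (N.minGens →₀ ℕ) →+ k :=
    { toFun := fun α => N.evalBinom φ (N.deg_nsmul_eq i α)
      map_zero' := hz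
      map_add' := hadd }
  have : g =
      Finsupp.weight (fun j => N.evalBinom φ (N.deg_nsmul_eq i (Finsupp.single j 1))) := by
    ext j
    simp [Finsupp.weight_single, g]
  exact DFunLike.congr_fun this α

/-- On the curve a homomorphism `I/I² → k[N]` is induced by a derivation near the smooth point
`t = 1`. -/
theorem exists_evalBinom_eq [CharZero k] : ∃ a : N.minGens → k, ∀ (α β : N.minGens →₀ ℕ)
    (h : N.deg α = N.deg β),
    N.evalBinom φ h = Finsupp.weight a α - Finsupp.weight a β := by
  obtain ⟨i⟩ := N.nonempty_minGens
  have hi : ((i : ℕ) : k) ≠ 0 := Nat.cast_ne_zero.2 i.2.2.1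
  -- Here `a_j` is `1/n_i` times the value on `X_j^(n_i) - X_i^(n_j)`; characteristic zero permits
  -- the division.
  refine ⟨fun j => ((i : ℕ) : k)⁻¹ *
    N.evalBinom φ (N.deg_nsmul_eq i (Finsupp.single j 1)), fun α β h => ?_⟩
  have h1 : N.deg ((i : ℕ) • α) = N.deg ((i : ℕ) • β) := by
    rw [N.deg_nsmul_eq, N.deg_nsmul_eq, h]
  -- Pass from `n_i α` through `n_i β` to the power of `X_i`, which is the same for both since `α`
  -- and `β` have equal weight.
  have h2 : N.evalBinom φ (N.deg_nsmul_eq i α) =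
      N.evalBinom φ h1 + N.evalBinom φ (N.deg_nsmul_eq i β) := by
    rw [← N.evalBinom_trans φ h1 (N.deg_nsmul_eq i β)]
    simp only [h]
  rw [N.evalBinom_nsmul φ h, N.evalBinom_nsmul_single, N.evalBinom_nsmul_single] at h2
  simp only [Finsupp.weight_eq_sum] at h2 ⊢
  simp only [← mul_smul_comm, ← Finset.mul_sum]
  rw [← mul_sub, h2]
  field_simp
  ring

end EvalOne

/-- The vector `(n₁, …, n_r)`. -/
def genVec (k : Type*) [Field k] : N.minGens → k := fun j => ((j : ℕ) : k)

theorem weight_genVec (α : N.minGens →₀ ℕ) :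
    Finsupp.weight (N.genVec k) α = (N.deg α : k) := by
  rw [deg, Finsupp.weight_eq_sum, Finsupp.weight_eq_sum]
  simp [genVec, varWeight]

theorem genVec_mem_annihilator (l : ℕ) : N.genVec k ∈ N.annihilator k l := by
  intro α β h _
  rw [weight_genVec, weight_genVec, h]

/-- The relation `X_j^(n_i) = X_i^(n_j)` forces `n_i b_j = n_j b_i`. -/
theorem mem_span_genVec [CharZero k] {b : N.minGens → k}
    (hb : ∀ α β, N.deg α = N.deg β → Finsupp.weight b α = Finsupp.weight b β) :
    b ∈ Submodule.span k {N.genVec k} := by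
  obtain ⟨i⟩ := N.nonempty_minGens
  have hi : ((i : ℕ) : k) ≠ 0 := Nat.cast_ne_zero.2 i.2.2.1
  refine Submodule.mem_span_singleton.2 ⟨b i / ((i : ℕ) : k), funext fun j => ?_⟩
  have := hb _ _ (N.deg_nsmul_eq i (Finsupp.single j 1))
  simp only [deg, Finsupp.weight_single, map_nsmul, one_smul, varWeight, nsmul_eq_mul] at this
  rw [Pi.smul_apply, smul_eq_mul, genVec]
  field_simp
  linear_combination -this

variable (k) in
/-- The vectors `a` such that `X_j ↦ a_j t^(n_j + l)` defines a derivation with values in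
`k[N]`. -/
def derivVec (l : ℕ) : Submodule k (N.minGens → k) where
  carrier := {a | ∀ j : N.minGens, (j : ℕ) + l ∉ N.carrier → a j = 0}
  add_mem' ha hb j hj := by rw [Pi.add_apply, ha j hj, hb j hj, add_zero]
  zero_mem' _ _ := rfl
  smul_mem' c a ha j hj := by rw [Pi.smul_apply, ha j hj, smul_zero]

theorem weight_eq_zero_of_mem_derivVec {a : N.minGens → k} {l : ℕ} (ha : a ∈ N.derivVec k l)
    {α : N.minGens →₀ ℕ} (hl : N.deg α + l ∉ N.carrier) : Finsupp.weight a α = 0 := by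
  rw [Finsupp.weight_eq_sum]
  refine Finset.sum_eq_zero fun j _ => ?_
  by_cases hj : α j = 0
  · rw [hj, zero_smul]
  · rw [ha j fun h => hl (N.deg_add_mem hj h), smul_zero]

variable (k) in
/-- The vectors that define a trivial element of `T¹(k[N])_l`. -/
def trivialVec (l : ℕ) : Submodule k (N.minGens → k) :=
  N.derivVec k l ⊔ Submodule.span k {N.genVec k}

theorem trivialVec_le (l : ℕ) : N.trivialVec k l ≤ N.annihilator k l := by
  refine sup_le (fun a ha α β h hl => ?_) ?_
  · rw [N.weight_eq_zero_of_mem_derivVec ha hl, N.weight_eq_zero_of_mem_derivVec ha (h ▸ hl)]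
  · rw [Submodule.span_singleton_le_iff_mem]
    exact N.genVec_mem_annihilator l

theorem trivialVec_eq_top {l : ℕ} (hl : l ∈ N.endo) : N.trivialVec k l = ⊤ := by
  rw [trivialVec, show N.derivVec k l = ⊤ from
    eq_top_iff.2 fun a _ j hj => absurd ((N.mem_endo_iff l).1 hl j) hj, top_sup_eq]

/-- The vector is read off at `t = 1`. If `d + l ∉ N`, the value lies in a zero component, which is
the condition defining `annihilator`. -/
theorem exists_eq_shiftHom [CharZero k] {l : ℕ}
    {φ : Module.Dual (N.SemigroupAlgebra k) (N.presentation k).toExtension.Cotangent}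
    (hφ : φ ∈ N.homDegree k l) :
    ∃ (a : N.minGens → k) (ha : a ∈ N.annihilator k l), φ = N.shiftHom ha := by
  obtain ⟨a, ha⟩ := N.exists_evalBinom_eq φ
  have key : ∀ α β (h : N.deg α = N.deg β), φ (N.binomClass k h) =
      N.evalBinom φ h • N.mono k (N.deg α + l) := by
    intro α β h
    refine N.eq_evalOne_smul_mono ?_
    rw [Nat.cast_add]
    refine hφ _ _ _ ?_
    exact Submodule.sub_mem (weightedHomogeneousSubmodule k N.varWeight (N.deg α))
      (isWeightedHomogeneous_monomial _ _ _ rfl) (isWeightedHomogeneous_monomial _ _ _ h.symm)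
  have hmem : a ∈ N.annihilator k l := by
    intro α β h hl
    have h1 := key α β h
    rw [N.mono_of_notMem k hl, smul_zero] at h1
    have h2 := ha α β h
    rw [evalBinom, h1, map_zero] at h2
    exact (sub_eq_zero.1 h2.symm)
  refine ⟨a, hmem, N.dual_ext_binom fun α β h => ?_⟩
  rw [key α β h, ha α β h, N.shiftHom_binomClass]

/-- The part in `derivVec` is induced by `X_j ↦ b_j t^(n_j + l)`; the multiple of `genVec` pairs to
zero with every isobaric `α - β`. -/
theorem shiftHom_mem_range {a : N.minGens → k} {l : ℕ} (ha : a ∈ N.annihilator k l)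
    (ha' : a ∈ N.trivialVec k l) :
    N.shiftHom ha ∈
      LinearMap.range (N.presentation k).toExtension.cotangentComplex.dualMap := by
  obtain ⟨b, hb, c, hc, rfl⟩ := Submodule.mem_sup.1 ha'
  obtain ⟨c, rfl⟩ := Submodule.mem_span_singleton.1 hc
  refine ⟨(N.presentation k).cotangentSpaceBasis.constr (N.SemigroupAlgebra k)
    fun j => b j • N.mono k (j + l), N.dual_ext_binom fun α β h => ?_⟩
  rw [shiftHom_binomClass, LinearMap.dualMap_apply]
  have hb' : Finsupp.weight (b + c • N.genVec k) α - Finsupp.weight (b + c • N.genVec k) β =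
      Finsupp.weight b α - Finsupp.weight b β := by
    have := N.weight_genVec (k := k) α
    have h2 := N.weight_genVec (k := k) β
    rw [← h] at h2
    have h3 := this.trans h2.symm
    simp only [Finsupp.weight_eq_sum, Pi.add_apply, Pi.smul_apply, smul_add,
      Finset.sum_add_distrib, smul_comm _ c, ← Finset.smul_sum] at h3 ⊢
    rw [h3]
    ring
  have hterm : ∀ (γ : N.minGens →₀ ℕ) (j : N.minGens),
      N.toAlg k (pderiv j (monomial γ 1)) * (b j • N.mono k (j + l)) =
        (γ j * b j) • N.mono k (N.deg γ + l) := by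
    intro γ j
    by_cases hγ : γ j = 0
    · rw [toAlg_pderiv_monomial]; simp [hγ]
    by_cases hj : (j : ℕ) + l ∈ N.carrier
    · have : N.deg (γ - Finsupp.single j 1) + (j : ℕ) = N.deg γ :=
        Finsupp.weight_sub_single_add (w := N.varWeight) hγ
      rw [toAlg_pderiv_monomial, smul_mul_smul_comm, N.mono_mul_mono k (N.deg_mem _) hj,
        ← add_assoc, this]
    · rw [hb j hj]; simp
  rw [apply_cotangentComplex_binomClass, hb']
  simp only [Module.Basis.constr_basis, map_sub, sub_mul, hterm]
  rw [Finset.sum_sub_distrib, ← Finset.sum_smul, ← Finset.sum_smul, h, ← sub_smul,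
    Finsupp.weight_eq_sum, Finsupp.weight_eq_sum]
  simp

end NumericalSemigroup

/-! ### The positive part of `T¹` as a quotient of spaces of vectors. -/

namespace NumericalSemigroup

open MvPolynomial
open scoped Pointwise

variable (N : NumericalSemigroup) (k : Type*) [Field k]

/-- The linear map from the annihilator to `T¹(k[N])`, whose image is the component of
degree `l`. -/
def annihilatorToT1 (l : ℕ) : N.annihilator k l →ₗ[k] N.T1 k :=
  ((LinearMap.range (N.presentation k).toExtension.cotangentComplex.dualMap).mkQ.restrictScalars
      k) ∘ₗ
    { toFun := fun a => N.shiftHom a.2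
      map_add' := fun a b => N.dual_ext_binom fun α β h => by
        rw [LinearMap.add_apply]
        simp only [binomClass, shiftHom_idealClass, Submodule.coe_add, shiftDeriv_add,
          LinearMap.add_apply]
      map_smul' := fun c a => N.dual_ext_binom fun α β h => by
        rw [LinearMap.smul_apply]
        simp only [binomClass, shiftHom_idealClass, Submodule.coe_smul, shiftDeriv_smul,
          LinearMap.smul_apply, RingHom.id_apply] }

variable {k}

theorem annihilatorToT1_apply {l : ℕ} (a : N.annihilator k l) :
    N.annihilatorToT1 k l a =
      (LinearMap.range (N.presentation k).toExtension.cotangentComplex.dualMap).mkQ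
        (N.shiftHom a.2) := rfl

theorem annihilatorToT1_eq_zero {l : ℕ} (a : N.annihilator k l)
    (ha : (a : N.minGens → k) ∈ N.trivialVec k l) : N.annihilatorToT1 k l a = 0 := by
  rw [annihilatorToT1_apply]
  exact (Submodule.Quotient.mk_eq_zero _).2 (N.shiftHom_mem_range a.2 ha)

theorem range_annihilatorToT1 [CharZero k] (l : ℕ) :
    LinearMap.range (N.annihilatorToT1 k l) = N.T1Degree k l := by
  apply le_antisymm
  · rintro _ ⟨a, rfl⟩
    exact ⟨N.shiftHom a.2, N.shiftHom_mem_homDegree a.2, rfl⟩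
  · rintro _ ⟨φ, hφ, rfl⟩
    obtain ⟨a, ha, rfl⟩ := N.exists_eq_shiftHom hφ
    exact ⟨⟨a, ha⟩, rfl⟩

/-- This gives at once the independence of the graded pieces and the kernel in each degree. If the
sum is induced by `θ`, the coefficient of `t^(d+l)` isolates the summand of degree `l`, which then
agrees on all binomials with the degree `l` part `b` of `θ`; hence `f l - b` is a multiple of
`genVec`. -/
theorem mem_trivialVec_of_sum_eq_zero [CharZero k] {s : Finset ℕ}
    (f : ∀ l : s, N.annihilator k l) (hf : ∑ l : s, N.annihilatorToT1 k l (f l) = 0) (l : s) :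
    (f l : N.minGens → k) ∈ N.trivialVec k l := by
  have h0 : (∑ l : s, N.shiftHom (f l).2) ∈
      LinearMap.range (N.presentation k).toExtension.cotangentComplex.dualMap := by
    rw [← Submodule.Quotient.mk_eq_zero, ← Submodule.mkQ_apply, map_sum]
    exact hf
  obtain ⟨θ, hθ⟩ := h0
  let b : N.minGens → k := fun j =>
    N.coeffAt k (j + l) (θ ((N.presentation k).cotangentSpaceBasis j))
  have hb : b ∈ N.derivVec k l := fun j hj => N.coeffAt_of_notMem k hj _
  have key : ∀ α β, N.deg α = N.deg β →
      Finsupp.weight ((f l : N.minGens → k) - b) α =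
        Finsupp.weight ((f l : N.minGens → k) - b) β := by
    intro α β h
    have h1 := congrArg (N.coeffAt k (N.deg α + l)) (LinearMap.congr_fun hθ (N.binomClass k h))
    rw [LinearMap.dualMap_apply, N.coeffAt_apply_cotangentComplex, LinearMap.sum_apply, map_sum,
      Finset.sum_eq_single l] at h1
    · have h2 : Finsupp.weight (f l : N.minGens → k) α - Finsupp.weight (f l : N.minGens → k) β =
          Finsupp.weight b α - Finsupp.weight b β := by
        refine Eq.trans ?_ h1.symm
        rw [shiftHom_binomClass, map_smul]
        by_cases hl : N.deg α + l ∈ N.carrier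
        · rw [N.coeffAt_mono k hl, if_pos rfl, smul_eq_mul, mul_one]
        · rw [(f l).2 α β h hl, sub_self, zero_smul]
      simp only [Finsupp.weight_eq_sum, Pi.sub_apply, smul_sub, Finset.sum_sub_distrib] at h2 ⊢
      linear_combination h2
    · intro l' _ hl'
      rw [shiftHom_binomClass, map_smul]
      by_cases hl : N.deg α + l' ∈ N.carrier
      · rw [N.coeffAt_mono k hl, if_neg, smul_zero]
        exact fun h => hl' (Subtype.ext (Nat.add_left_cancel h))
      · rw [N.mono_of_notMem k hl, map_zero, smul_zero]
    · simp
  have := Submodule.add_mem_sup hb (N.mem_span_genVec key)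
  rwa [add_sub_cancel] at this

variable (k) in
/-- The sum of the maps `annihilatorToT1` over the degrees outside `End(N)`. -/
def sumAnnihilatorToT1 :
    (∀ l : N.finite_compl_endo.toFinset, N.annihilator k l) →ₗ[k] N.T1 k :=
  LinearMap.lsum k (fun l : N.finite_compl_endo.toFinset => N.annihilator k l) k
    fun l => N.annihilatorToT1 k l

theorem sumAnnihilatorToT1_apply
    (f : ∀ l : N.finite_compl_endo.toFinset, N.annihilator k l) :
    N.sumAnnihilatorToT1 k f = ∑ l : N.finite_compl_endo.toFinset, N.annihilatorToT1 k l (f l) := by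
  simp [sumAnnihilatorToT1, LinearMap.lsum_apply]

theorem mem_ker_sumAnnihilatorToT1 [CharZero k]
    (f : ∀ l : N.finite_compl_endo.toFinset, N.annihilator k l) :
    f ∈ LinearMap.ker (N.sumAnnihilatorToT1 k) ↔
      ∀ l : N.finite_compl_endo.toFinset, (f l : N.minGens → k) ∈ N.trivialVec k l := by
  rw [LinearMap.mem_ker, sumAnnihilatorToT1_apply]
  exact ⟨N.mem_trivialVec_of_sum_eq_zero f,
    fun h => Finset.sum_eq_zero fun l _ => N.annihilatorToT1_eq_zero _ (h l)⟩

theorem range_sumAnnihilatorToT1 [CharZero k] :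
    LinearMap.range (N.sumAnnihilatorToT1 k) = N.T1Pos k := by
  apply le_antisymm
  · rintro _ ⟨f, rfl⟩
    rw [sumAnnihilatorToT1_apply]
    refine sum_mem fun l _ => ?_
    -- Since `0 ∈ End(N)`, every degree outside `End(N)` is positive.
    have hl : (0 : ℤ) < ((l : ℕ) : ℤ) := by
      have hl : (l : ℕ) ∉ N.endo := N.finite_compl_endo.mem_toFinset.1 l.2
      have h0 : (0 : ℕ) ∈ N.endo := fun m hm _ => by rwa [zero_add]
      have : (l : ℕ) ≠ 0 := fun h => hl (h ▸ h0)
      omega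
    refine (le_iSup₂_of_le (f := fun (l : ℤ) (_ : 0 < l) => N.T1Degree k l) _ hl le_rfl) ?_
    rw [← range_annihilatorToT1]
    exact ⟨f l, rfl⟩
  · refine iSup₂_le fun l hl => ?_
    lift l to ℕ using hl.le
    rw [← range_annihilatorToT1]
    rintro _ ⟨a, rfl⟩
    by_cases h : l ∈ N.endo
    · rw [N.annihilatorToT1_eq_zero a (by rw [N.trivialVec_eq_top h]; trivial)]
      exact zero_mem _
    · refine ⟨Pi.single ⟨l, by simpa using h⟩ a, ?_⟩
      rw [sumAnnihilatorToT1_apply, Finset.sum_eq_single ⟨l, by simpa using h⟩]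
      · rw [Pi.single_eq_same]
      · intro l' _ hl'
        rw [Pi.single_eq_of_ne hl', map_zero]
      · simp

theorem finite_T1Pos [CharZero k] : Module.Finite k (N.T1Pos k) := by
  rw [← range_sumAnnihilatorToT1]
  infer_instance

/-- Rank-nullity: the kernel of `sumAnnihilatorToT1` is the product of the spaces `trivialVec`. -/
theorem finrank_T1Pos_add [CharZero k] :
    Module.finrank k (N.T1Pos k) +
      ∑ l ∈ N.finite_compl_endo.toFinset, Module.finrank k (N.trivialVec k l) =
        ∑ l ∈ N.finite_compl_endo.toFinset, Module.finrank k (N.annihilator k l) := by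
  have h := LinearMap.finrank_range_add_finrank_ker (N.sumAnnihilatorToT1 k)
  let e : LinearMap.ker (N.sumAnnihilatorToT1 k) ≃ₗ[k]
      (∀ l : N.finite_compl_endo.toFinset, N.trivialVec k l) :=
    { toFun := fun f l => ⟨f.1 l, (N.mem_ker_sumAnnihilatorToT1 f.1).1 f.2 l⟩
      map_add' := fun _ _ => rfl
      map_smul' := fun _ _ => rfl
      invFun := fun g => ⟨fun l : N.finite_compl_endo.toFinset => ⟨g l, N.trivialVec_le l (g l).2⟩,
        (N.mem_ker_sumAnnihilatorToT1 _).2 fun l => (g l).2⟩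
      left_inv := fun _ => rfl
      right_inv := fun _ => rfl }
  rw [range_sumAnnihilatorToT1, e.finrank_eq, Module.finrank_pi_fintype,
    Module.finrank_pi_fintype] at h
  rw [← Finset.sum_coe_sort, ← Finset.sum_coe_sort _ fun l => Module.finrank k (N.annihilator k l)]
  exact h

/-! ### Dimension counts. -/

variable (k) in
open Classical in
theorem finrank_derivVec_add (l : ℕ) :
    Module.finrank k (N.derivVec k l) +
      (Finset.univ.filter fun j : N.minGens => (j : ℕ) + l ∉ N.carrier).card =
        Fintype.card N.minGens := by
  let J := {j : N.minGens // (j : ℕ) + l ∉ N.carrier}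
  let r : (N.minGens → k) →ₗ[k] (J → k) := LinearMap.funLeft k k Subtype.val
  have hr : Function.Surjective r :=
    LinearMap.funLeft_surjective_of_injective _ _ _ Subtype.val_injective
  have hker : LinearMap.ker r = N.derivVec k l := by
    ext a
    exact ⟨fun h j hj => congrFun h ⟨j, hj⟩, fun h => funext fun j => h j.1 j.2⟩
  have := LinearMap.finrank_range_add_finrank_ker r
  rw [LinearMap.range_eq_top.2 hr, finrank_top, hker, Module.finrank_fintype_fun_eq_card,
    Module.finrank_fintype_fun_eq_card, Fintype.card_subtype] at this
  rw [add_comm]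
  exact this

-- For `l ∉ End(N)` some `n_j + l ∉ N`, where vectors of `derivVec` vanish but `genVec` has the
-- nonzero entry `n_j`. So the line of `genVec` adds exactly one dimension.
variable (k) in
open Classical in
theorem finrank_trivialVec_add [CharZero k] {l : ℕ} (hl : l ∉ N.endo) :
    Module.finrank k (N.trivialVec k l) +
      (Finset.univ.filter fun j : N.minGens => (j : ℕ) + l ∉ N.carrier).card =
        Fintype.card N.minGens + 1 := by
  obtain ⟨j, hj⟩ := not_forall.1 fun h => hl ((N.mem_endo_iff l).2 h)
  have hj0 : N.genVec k j ≠ 0 := Nat.cast_ne_zero.2 j.2.2.1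
  have hdisj : N.derivVec k l ⊓ Submodule.span k {N.genVec k} = ⊥ := by
    refine (Submodule.eq_bot_iff _).2 fun x hx => ?_
    obtain ⟨c, rfl⟩ := Submodule.mem_span_singleton.1 hx.2
    have := hx.1 j hj
    rw [Pi.smul_apply, smul_eq_mul, mul_eq_zero, or_iff_left hj0] at this
    rw [this, zero_smul]
  have h1 := Submodule.finrank_sup_add_finrank_inf_eq (N.derivVec k l)
    (Submodule.span k {N.genVec k})
  rw [hdisj, finrank_bot, add_zero, finrank_span_singleton fun h => hj0 (congrFun h j)] at h1
  rw [trivialVec, h1, ← N.finrank_derivVec_add k l]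
  ring

/-- `I` is the `k`-span of the products `X^γ F_i`. If such a product has the weight of `α` and
weight plus `l` is not in `N`, then `d_i + l ∉ N` too, and `a` is orthogonal to `α_i - β_i`. -/
theorem mem_annihilator_of_isBinomialSystem
    {S : Set ((N.minGens →₀ ℕ) × (N.minGens →₀ ℕ))} (hS : N.IsBinomialSystem k S)
    {a : N.minGens → k} {l : ℕ}
    (ha : ∀ p ∈ S, N.deg p.1 + l ∉ N.carrier → Finsupp.weight a p.1 = Finsupp.weight a p.2) :
    a ∈ N.annihilator k l := by
  intro α β h hl
  -- The cutoff to the weight of `α` makes `f` vanish on multiples of generators in other weights,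
  -- about which `ha` may say nothing.
  let f : MvPolynomial N.minGens k →ₗ[k] k := (basisMonomials N.minGens k).constr k
    fun γ => if N.deg γ = N.deg α then Finsupp.weight a γ else 0
  have hf : ∀ γ, f (monomial γ 1) = if N.deg γ = N.deg α then Finsupp.weight a γ else 0 := by
    intro γ
    have := (basisMonomials N.minGens k).constr_basis k
      (fun γ => if N.deg γ = N.deg α then Finsupp.weight a γ else 0) γ
    rwa [coe_basisMonomials] at this
  have hmem : N.binom k α β ∈ Ideal.span
      ((fun p => monomial p.1 (1 : k) - monomial p.2 (1 : k)) '' S) := by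
    rw [hS.span_eq]
    exact N.toAlg_binom k h
  have key : f (N.binom k α β) = 0 := by
    have h1 : N.binom k α β ∈ Submodule.span k
        (Set.range (fun γ : N.minGens →₀ ℕ => (monomial γ 1 : MvPolynomial N.minGens k)) •
          ((fun p => monomial p.1 (1 : k) - monomial p.2 (1 : k)) '' S)) := by
      rw [Submodule.span_smul_of_span_eq_top]
      · exact hmem
      · rw [← coe_basisMonomials]
        exact (basisMonomials N.minGens k).span_eq
    refine (Submodule.span_le (p := LinearMap.ker f)).2 ?_ h1
    rintro _ ⟨_, ⟨γ, rfl⟩, _, ⟨p, hp, rfl⟩, rfl⟩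
    have hp' : N.deg p.1 = N.deg p.2 := hS.isobaric p hp
    change f (monomial γ (1 : k) * N.binom k p.1 p.2) = 0
    rw [monomial_mul_binom, map_sub, hf, hf, N.deg_add, N.deg_add, ← hp']
    split_ifs with hγ
    · rw [map_add, map_add, ha p hp, sub_self]
      intro hm
      refine hl ?_
      rw [← hγ, add_assoc]
      exact add_mem (N.deg_mem γ) hm
    · exact sub_self _
  rw [map_sub, hf, hf, if_pos rfl, if_pos h.symm, sub_eq_zero] at key
  exact key

/-- Under the standard pairing on `k^r`, `annihilator` is the orthogonal of `V_l`. -/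
theorem finrank_annihilator_add {S : Set ((N.minGens →₀ ℕ) × (N.minGens →₀ ℕ))}
    (hS : N.IsBinomialSystem k S) (l : ℕ) :
    Module.finrank k (N.annihilator k l) + Module.finrank k (N.V k S l) =
      Fintype.card N.minGens := by
  classical
  let e := (Pi.basisFun k N.minGens).toDualEquiv
  have he : ∀ a v, e a v = ∑ j, a j * v j := by
    intro a v
    conv_lhs => rw [← (Pi.basisFun k N.minGens).sum_repr v, map_sum]
    refine Finset.sum_congr rfl fun j _ => ?_
    rw [map_smul, Module.Basis.toDualEquiv_apply, Module.Basis.toDual_apply_left,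
      Pi.basisFun_repr, Pi.basisFun_repr, smul_eq_mul, mul_comm]
  have hsub : ∀ (a : N.minGens → k) (p : (N.minGens →₀ ℕ) × (N.minGens →₀ ℕ)),
      e a (fun n => (p.1 n : k) - (p.2 n : k)) =
        Finsupp.weight a p.1 - Finsupp.weight a p.2 := by
    intro a p
    rw [he, Finsupp.weight_eq_sum, Finsupp.weight_eq_sum, ← Finset.sum_sub_distrib]
    refine Finset.sum_congr rfl fun j _ => ?_
    rw [nsmul_eq_mul, nsmul_eq_mul]
    ring
  have hmem : ∀ a, e a ∈ (N.V k S l).dualAnnihilator ↔ a ∈ N.annihilator k l := by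
    intro a
    rw [Submodule.mem_dualAnnihilator]
    constructor
    · refine fun h => N.mem_annihilator_of_isBinomialSystem hS fun p hp hl => ?_
      rw [← sub_eq_zero, ← hsub]
      exact h _ (Submodule.subset_span ⟨p, ⟨hp, hl⟩, rfl⟩)
    · intro h v hv
      refine (Submodule.span_le (p := LinearMap.ker (e a))).2 ?_ hv
      rintro _ ⟨p, ⟨hp, hl⟩, rfl⟩
      change e a _ = 0
      rw [hsub, sub_eq_zero]
      exact h _ _ (hS.isobaric p hp) hl
  have hmap : (N.annihilator k l).map e.toLinearMap = (N.V k S l).dualAnnihilator := by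
    ext θ
    obtain ⟨a, rfl⟩ := e.surjective θ
    rw [hmem]
    exact ⟨fun ⟨b, hb, hab⟩ => e.injective hab ▸ hb, fun h => ⟨a, h, rfl⟩⟩
  have := Subspace.finrank_add_finrank_dualAnnihilator_eq (N.V k S l)
  rw [← hmap, LinearEquiv.finrank_map_eq, Module.finrank_fintype_fun_eq_card] at this
  rw [add_comm]
  exact this

-- The bijection is `(l, j) ↦ (n_j + l, j)`. Conversely, a gap `m > n_j` gives `l = m - n_j`, which
-- is outside `End(N)` because `n_j + l = m ∉ N`.
open Classical in
theorem sum_card_eq_effectiveWeight :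
    ∑ l ∈ N.finite_compl_endo.toFinset,
      (Finset.univ.filter fun j : N.minGens => (j : ℕ) + l ∉ N.carrier).card =
        N.effectiveWeight := by
  have h1 : ∀ l ∈ N.gaps, {n ∈ N.minGens | n < l}.ncard =
      (Finset.univ.filter fun j : N.minGens => (j : ℕ) < l).card := by
    intro l _
    rw [← Set.ncard_coe_finset, ← Set.ncard_image_of_injective _ Subtype.val_injective]
    congr 1
    ext n
    simp [and_comm]
  rw [effectiveWeight, Finset.sum_congr rfl h1, ← Finset.card_sigma, ← Finset.card_sigma]
  refine Finset.card_bij' (fun p _ => ⟨(p.2 : ℕ) + p.1, p.2⟩) (fun p _ => ⟨p.1 - (p.2 : ℕ), p.2⟩)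
    ?_ ?_ ?_ ?_
  · rintro ⟨l, j⟩ h
    simp only [Finset.mem_sigma, Set.Finite.mem_toFinset, Set.mem_compl_iff, Finset.mem_filter,
      Finset.mem_univ, true_and, gaps, SetLike.mem_coe] at h ⊢
    refine ⟨h.2, ?_⟩
    -- This yields the strict inequality `n_j < n_j + l` required by `ewt`.
    have : l ≠ 0 := by
      rintro rfl
      exact h.2 j.2.1
    omega
  · rintro ⟨l, j⟩ h
    simp only [Finset.mem_sigma, Set.Finite.mem_toFinset, Set.mem_compl_iff, Finset.mem_filter,
      Finset.mem_univ, true_and, gaps, SetLike.mem_coe, N.mem_endo_iff] at h ⊢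
    have h2 : (j : ℕ) + (l - j) = l := by omega
    refine ⟨fun h3 => h.1 (h2 ▸ h3 j), by rw [h2]; exact h.1⟩
  · rintro ⟨l, j⟩ h
    simp
  · rintro ⟨l, j⟩ h
    simp only [Finset.mem_sigma, Finset.mem_filter] at h
    have h2 : (j : ℕ) + (l - j) = l := by omega
    simp [h2]

theorem card_compl_endo_add_lambda :
    N.finite_compl_endo.toFinset.card + N.lambda = N.genus := by
  have hfin : (N.endo \ (N.carrier : Set ℕ)).Finite := N.finite_compl.subset fun _ h => h.2
  have hunion : N.endoᶜ ∪ (N.endo \ (N.carrier : Set ℕ)) = (N.carrier : Set ℕ)ᶜ := by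
    ext x
    have : x ∈ (N.carrier : Set ℕ) → x ∈ N.endo := fun hx m hm _ => add_mem hx hm
    simp only [Set.mem_union, Set.mem_compl_iff, Set.mem_sdiff]
    tauto
  have hdisj : Disjoint N.endoᶜ (N.endo \ (N.carrier : Set ℕ)) :=
    Set.disjoint_left.2 fun x hx hx' => hx hx'.1
  rw [genus, gaps, lambda, ← Set.ncard_eq_toFinset_card _ N.finite_compl_endo,
    ← Set.ncard_eq_toFinset_card _ N.finite_compl, ← hunion,
    Set.ncard_union_eq hdisj N.finite_compl_endo hfin]

/-- Each summand equals `-dim V_l` for any binomial system. Stated without one, the formula gives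
the inequality from `dim annihilator ≤ r` alone. -/
theorem finrank_T1Pos_eq [CharZero k] :
    (Module.finrank k (N.T1Pos k) : ℤ) =
      ∑ l ∈ N.finite_compl_endo.toFinset,
        ((Module.finrank k (N.annihilator k l) : ℤ) - Fintype.card N.minGens) +
      N.effectiveWeight + N.lambda - N.genus := by
  classical
  have h1 := N.finrank_T1Pos_add (k := k)
  have h2 : ∑ l ∈ N.finite_compl_endo.toFinset, (Module.finrank k (N.trivialVec k l) +
      (Finset.univ.filter fun j : N.minGens => (j : ℕ) + l ∉ N.carrier).card) =
      ∑ _l ∈ N.finite_compl_endo.toFinset, (Fintype.card N.minGens + 1) :=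
    Finset.sum_congr rfl fun l hl => N.finrank_trivialVec_add k (by simpa using hl)
  rw [Finset.sum_add_distrib, sum_card_eq_effectiveWeight, Finset.sum_const, smul_eq_mul] at h2
  have h3 := N.card_compl_endo_add_lambda
  rw [Finset.sum_sub_distrib, Finset.sum_const, nsmul_eq_mul]
  zify at h1 h2 h3
  linear_combination h1 - h2 - h3

end NumericalSemigroup

end

theorem proposition2p7 (k : Type*) [Field k] [IsAlgClosed k] [CharZero k]
    (N : NumericalSemigroup) :
    Module.Finite k (N.T1Pos k) ∧
    (3 * (N.genus : ℤ) - 2 - N.effectiveWeight ≤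
      2 * (N.genus : ℤ) - 2 + N.lambda - Module.finrank k (N.T1Pos k)) ∧
    ∀ S : Set ((N.minGens →₀ ℕ) × (N.minGens →₀ ℕ)), N.IsBinomialSystem k S →
      (2 * (N.genus : ℤ) - 2 + N.lambda - Module.finrank k (N.T1Pos k)) -
          (3 * (N.genus : ℤ) - 2 - N.effectiveWeight) =
        ∑ l ∈ N.finite_compl_endo.toFinset, (Module.finrank k (N.V k S l) : ℤ) := by
  have h := N.finrank_T1Pos_eq (k := k)
  refine ⟨N.finite_T1Pos, ?_, fun S hS => ?_⟩
  · have : ∑ l ∈ N.finite_compl_endo.toFinset,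
        ((Module.finrank k (N.annihilator k l) : ℤ) - Fintype.card N.minGens) ≤ 0 := by
      refine Finset.sum_nonpos fun l _ => ?_
      have := Submodule.finrank_le (N.annihilator k l)
      rw [Module.finrank_fintype_fun_eq_card] at this
      omega
    linarith
  · have h1 : ∑ l ∈ N.finite_compl_endo.toFinset, (Module.finrank k (N.V k S l) : ℤ) =
        -∑ l ∈ N.finite_compl_endo.toFinset,
        ((Module.finrank k (N.annihilator k l) : ℤ) - Fintype.card N.minGens) := by
      rw [← Finset.sum_neg_distrib]
      refine Finset.sum_congr rfl fun l _ => ?_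
      have := N.finrank_annihilator_add hS l
      omega
    rw [h1]
    linarith
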